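/- Let $N,M\ge 1$. Let $\mathcal G_1,\dots,\mathcal G_M$ be weighted directed graphs on the nodes $\{1,\dots,N\}$ with nonnegative adjacency matrices $A_\ell=[a^{\ell}_{ik}]$ ($a^\ell_{ik}>0$ exactly when $(k,i)$ is an edge of $\mathcal G_\ell$) and Laplacians $L_\ell=\mathrm{diag}\big(\sum_k a^\ell_{ik}\big)_i-A_\ell$. A graph is strongly connected if there is a directed path between any two distinct nodes of it. A basis bicomponent of $\mathcal G_\ell$ is a (nonempty) strongly connected induced subgraph that receives no edge from the other nodes of $\mathcal G_\ell$. Let $0=t_1<t_2<\cdots$ be switching times and $\bar n:\{1,2,\dots\}\to\{1,\dots,M\}$ a map such that $\mathcal G_{\bar n(j)}$ is the active graph on $[t_j,t_{j+1})$; write $a_{ik}(t)$ for its weights and $L(t)$ for its Laplacian. Assume: (a) the graphs have a jointly strongly connected basis: the union of all basis bicomponents of all $\mathcal G_\ell$ is a strongly connected graph whose vertices are all of $\{1,\dots,N\}$; (b) there is $\tau_{\min}>0$ with $t_{j+1}-t_j>\tau_{\min}$ for all $j\ge 1$; (c) there is $\tau_{\max}>0$ such that for each $\ell$ there are activation and deactivation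 times $T^a_{\ell 1}<T^d_{\ell 1}\le T^a_{\ell 2}<T^d_{\ell 2}\le\cdots$ in $\{t_j\}_{j\ge 1}$ with $L(t)=L_\ell$ for $t\in[T^a_{\ell\nu},T^d_{\ell\nu})$ and $T^a_{\ell,\nu+1}-T^d_{\ell\nu}\le\tau_{\max}$ for all $\nu\ge 1$. Consider the agents $\dot x_i=b_iu_i$, $i=1,\dots,N$, with real constants $b_i\ne 0$ (unknown, possibly of different signs). Let $\lambda_1,\lambda_2>0$ and $$e_i(t)=\sum_{k=1}^N a_{ik}(t)\,\big(x_i(t)-x_k(t)\big),$$ $$S_i(t)=\frac{x_i(t)^2}{2}+\lambda_1\int_0^t x_i(s)^2e_i(s)^2\,ds+\frac{\lambda_2}{2}\Big[\int_0^t x_i(s)e_i(s)\,ds\Big]^2,$$ $$u_i(t)=S_i(t)\cos\big(S_i(t)\big)\,e_i(t)\Big[\lambda_1x_i(t)e_i(t)+\lambda_2\int_0^t x_i(s)e_i(s)\,ds\Big].$$ By a solution of the closed loop on $[0,T)$, $0<T\le\infty$, we mean a continuous function $x$ on $[0,T)$ that satisfies $\dot x_i=b_iu_i$ for all $i$ at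 every $t\in(0,T)$ that is not a switching time. Then for every initial state $x(0)\in\mathbb R^N$ the closed loop has a solution on $[0,\infty)$, and every solution on an interval $[0,T)$ with the same initial state is a restriction of it. Moreover, along this solution all $x_i$ and $u_i$ are bounded on $[0,\infty)$, and $\lim_{t\to\infty}\big(x_i(t)-x_k(t)\big)=0$ for all $i,k\in\{1,\dots,N\}$. -/

import Mathlib

open Set Filter Topology

noncomputable section

/-- A weighted directed graph on the nodes `Fin N`, given by its adjacency matrix `A`.
There is an edge from `k` to `i` exactly when `0 < A i k`. -/
structure WeightedDigraph (N : ℕ) where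
  A : Matrix (Fin N) (Fin N) ℝ
  nonneg : ∀ i k, 0 ≤ A i k

/-- `G.Edge k i`: node `i` receives information from node `k`. -/
def WeightedDigraph.Edge {N : ℕ} (G : WeightedDigraph N) (k i : Fin N) : Prop :=
  0 < G.A i k

/-- The Laplacian `D - A`, where `D` is the diagonal matrix of the in-degrees. -/
def WeightedDigraph.laplacian {N : ℕ} (G : WeightedDigraph N) : Matrix (Fin N) (Fin N) ℝ :=
  Matrix.diagonal (fun i => ∑ k, G.A i k) - G.A

/-- The directed graph with vertex set `S` and those edges of `E` that join vertices of `S` is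
strongly connected: there is a directed path in it between any two distinct vertices. -/
def StronglyConnectedOn {V : Type*} (S : Set V) (E : V → V → Prop) : Prop :=
  ∀ u ∈ S, ∀ v ∈ S, u ≠ v → Relation.TransGen (fun p q => p ∈ S ∧ q ∈ S ∧ E p q) u v

/-- `S` is the vertex set of a basis bicomponent of `G`: the subgraph induced on `S` is strongly
connected and receives no link from a node outside `S`. -/
structure WeightedDigraph.IsBasisBicomponent {N : ℕ} (G : WeightedDigraph N)
    (S : Set (Fin N)) : Prop where
  nonempty : S.Nonempty
  stronglyConnected : StronglyConnectedOn S G.Edge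
  no_incoming : ∀ k, k ∉ S → ∀ i ∈ S, ¬ G.Edge k i

/-- The vertices of the union of all basis bicomponents of all the graphs `G ℓ`. -/
def basisUnionVertices {N M : ℕ} (G : Fin M → WeightedDigraph N) : Set (Fin N) :=
  {v | ∃ ℓ S, (G ℓ).IsBasisBicomponent S ∧ v ∈ S}

/-- The edges of the union of all basis bicomponents of all the graphs `G ℓ`. -/
def basisUnionEdge {N M : ℕ} (G : Fin M → WeightedDigraph N) (k i : Fin N) : Prop :=
  ∃ ℓ S, (G ℓ).IsBasisBicomponent S ∧ k ∈ S ∧ i ∈ S ∧ (G ℓ).Edge k i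

/-- The union of all basis bicomponents is a strongly connected graph on all the nodes. -/
structure HasJointlyStronglyConnectedBasis {N M : ℕ} (G : Fin M → WeightedDigraph N) : Prop where
  vertices : basisUnionVertices G = univ
  stronglyConnected : StronglyConnectedOn (basisUnionVertices G) (basisUnionEdge G)

/-- The switching topologies: `G ℓ` are the finitely many graphs, `t 0 = 0 < t 1 < t 2 < ⋯` the
switching times, `n j` the index of the graph that is active on `[t j, t (j + 1))`, and `Gt s` the
graph that is active at time `s`. Every graph `G ℓ` has a sequence of activation times `Ta ν` and
deactivation times `Td ν` among the switching times and is reactivated within `τmax`. -/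
structure SwitchingTopologies {N M : ℕ} (G : Fin M → WeightedDigraph N) (t : ℕ → ℝ)
    (n : ℕ → Fin M) (Gt : ℝ → WeightedDigraph N) : Prop where
  start : t 0 = 0
  active : ∀ j, ∀ s ∈ Ico (t j) (t (j + 1)), Gt s = G (n j)
  basis : HasJointlyStronglyConnectedBasis G
  dwell : ∃ τmin : ℝ, 0 < τmin ∧ ∀ j, τmin < t (j + 1) - t j
  reactivation : ∃ τmax : ℝ, 0 < τmax ∧ ∀ ℓ, ∃ Ta Td : ℕ → ℝ,
    (∀ ν, Ta ν ∈ range t) ∧ (∀ ν, Td ν ∈ range t) ∧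
    (∀ ν, Ta ν < Td ν) ∧ (∀ ν, Td ν ≤ Ta (ν + 1)) ∧
    (∀ ν, ∀ s ∈ Ico (Ta ν) (Td ν), (Gt s).laplacian = (G ℓ).laplacian) ∧
    (∀ ν, Ta (ν + 1) - Td ν ≤ τmax)

/-- The signal `e_i(t) = ∑ₖ a_ik(t) (x_i(t) - x_k(t))`. -/
def relErr {N : ℕ} (Gt : ℝ → WeightedDigraph N) (x : ℝ → Fin N → ℝ) (i : Fin N) (t : ℝ) : ℝ :=
  ∑ k, (Gt t).A i k * (x t i - x t k)

/-- The nonlinear PI term `S_i(t)`. -/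
def piTerm {N : ℕ} (Gt : ℝ → WeightedDigraph N) (lam1 lam2 : ℝ) (x : ℝ → Fin N → ℝ)
    (i : Fin N) (t : ℝ) : ℝ :=
  x t i ^ 2 / 2 + lam1 * (∫ s in (0 : ℝ)..t, x s i ^ 2 * relErr Gt x i s ^ 2)
    + lam2 / 2 * (∫ s in (0 : ℝ)..t, x s i * relErr Gt x i s) ^ 2

/-- The control input `u_i(t)` along the trajectory `x`. -/
def controlInput {N : ℕ} (Gt : ℝ → WeightedDigraph N) (lam1 lam2 : ℝ) (x : ℝ → Fin N → ℝ)
    (i : Fin N) (t : ℝ) : ℝ :=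
  piTerm Gt lam1 lam2 x i t * Real.cos (piTerm Gt lam1 lam2 x i t) * relErr Gt x i t
    * (lam1 * (x t i * relErr Gt x i t) + lam2 * ∫ s in (0 : ℝ)..t, x s i * relErr Gt x i s)

/-- `x` solves the closed loop `x_i' = b_i u_i` on the time interval `I`: it is continuous on `I`
and satisfies the differential equation at every interior time that is not a switching time. -/
structure IsClosedLoopSolution {N : ℕ} (Gt : ℝ → WeightedDigraph N) (t : ℕ → ℝ) (b : Fin N → ℝ)
    (lam1 lam2 : ℝ) (I : Set ℝ) (x : ℝ → Fin N → ℝ) : Prop where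
  continuousOn : ContinuousOn x I
  hasDerivAt : ∀ s ∈ interior I, s ∉ range t → ∀ i,
    HasDerivAt (fun r => x r i) (b i * controlInput Gt lam1 lam2 x i s) s

end

/-!
Together with the integrals of `x_i² e_i²` and `x_i e_i`, the closed loop becomes an ordinary
switched differential equation. Along it `S_i' = (b_i S_i cos S_i + 1) w_i` with `w_i` locally
bounded, and `b_i c cos c + 1 = 0` has arbitrarily large solutions `c`, whatever the sign of
`b_i`. By uniqueness `S_i` never crosses such a `c`, so all states stay bounded, and the solution
is global.

In particular `∫ x_i² e_i²` is finite, so a Barbalat argument on intervals of the dwell time gives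
`x_i e_i → 0`, hence `x_i x_i' → 0`: the states vary slowly. Since every graph reappears within a
bounded time, each cluster point `c` of `x` satisfies `c_i (L_ℓ c)_i = 0` for all graphs `ℓ`. At a
node of maximal `|c_i|` this forces all in-neighbours to have the same value, which spreads to all
nodes along the jointly strongly connected basis.
-/

open scoped Matrix

section RightDeriv

theorem mul_sub_le_image_sub_of_le_deriv_right {f f' : ℝ → ℝ} {a b m : ℝ} (hab : a ≤ b)
    (hf : ContinuousOn f (Icc a b)) (hf' : ∀ s ∈ Ico a b, HasDerivWithinAt f (f' s) (Ici s) s)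
    (hm : ∀ s ∈ Ico a b, m ≤ f' s) : m * (b - a) ≤ f b - f a := by
  have hlin (s : ℝ) : HasDerivAt (fun r => f a + m * (r - a)) m s := by
    simpa using (((hasDerivAt_id s).sub_const a).const_mul m).const_add (f a)
  have := image_le_of_deriv_right_le_deriv_boundary (by fun_prop)
    (fun s _ => (hlin s).hasDerivWithinAt) (by simp) hf hf' hm (right_mem_Icc.2 hab)
  linarith

theorem image_le_image_of_deriv_right_nonneg {f f' : ℝ → ℝ} {a b : ℝ} (hab : a ≤ b)
    (hf : ContinuousOn f (Icc a b)) (hf' : ∀ s ∈ Ico a b, HasDerivWithinAt f (f' s) (Ici s) s)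
    (hf₀ : ∀ s ∈ Ico a b, 0 ≤ f' s) : f a ≤ f b := by
  simpa using mul_sub_le_image_sub_of_le_deriv_right hab hf hf' hf₀

theorem ne_zero_of_norm_deriv_right_le {E : Type*} [NormedAddCommGroup E] [InnerProductSpace ℝ E]
    {f f' : ℝ → E} {a b L : ℝ} (hab : a ≤ b) (hf : ContinuousOn f (Icc a b))
    (hf' : ∀ s ∈ Ico a b, HasDerivWithinAt f (f' s) (Ici s) s)
    (hL : ∀ s ∈ Ico a b, ‖f' s‖ ≤ L * ‖f s‖) (ha : f a ≠ 0) : f b ≠ 0 := by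
  have hexp (s : ℝ) :
      HasDerivAt (fun r => Real.exp (2 * L * r)) (Real.exp (2 * L * s) * (2 * L)) s := by
    simpa using ((hasDerivAt_id s).const_mul (2 * L)).exp
  have hmono : ‖f a‖ ^ 2 * Real.exp (2 * L * a) ≤ ‖f b‖ ^ 2 * Real.exp (2 * L * b) := by
    refine image_le_image_of_deriv_right_nonneg (f := fun s => ‖f s‖ ^ 2 * Real.exp (2 * L * s)) hab
      (by fun_prop) (fun s hs => (hf' s hs).norm_sq.mul (hexp s).hasDerivWithinAt) fun s hs => ?_
    have hinner : -(L * ‖f s‖ ^ 2) ≤ inner ℝ (f s) (f' s) := by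
      have := neg_le_of_abs_le (abs_real_inner_le_norm (f s) (f' s))
      nlinarith [hL s hs, norm_nonneg (f s)]
    nlinarith [Real.exp_pos (2 * L * s)]
  intro hb
  have : 0 < ‖f a‖ ^ 2 * Real.exp (2 * L * a) := by positivity
  simp only [hb, norm_zero] at hmono
  linarith

theorem lt_of_abs_deriv_right_le {f f' : ℝ → ℝ} {a b c L : ℝ} (hab : a ≤ b)
    (hf : ContinuousOn f (Icc a b)) (hf' : ∀ s ∈ Ico a b, HasDerivWithinAt f (f' s) (Ici s) s)
    (hL : ∀ s ∈ Ico a b, |f' s| ≤ L * |f s - c|) (ha : f a < c) : f b < c := by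
  by_contra! hb
  obtain ⟨s, hs, hsc⟩ := intermediate_value_Icc hab hf ⟨ha.le, hb⟩
  have hsub : Icc a s ⊆ Icc a b := Icc_subset_Icc_right hs.2
  exact ne_zero_of_norm_deriv_right_le (f := fun r => f r - c) hs.1
    ((hf.mono hsub).sub continuousOn_const)
    (fun r hr => (hf' r ⟨hr.1, hr.2.trans_le hs.2⟩).sub_const c)
    (fun r hr => hL r ⟨hr.1, hr.2.trans_le hs.2⟩) (sub_ne_zero.2 ha.ne) (sub_eq_zero.2 hsc)

theorem lt_of_deriv_right_eq_mul {f w g : ℝ → ℝ} {a b c C : ℝ} (hab : a ≤ b)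
    (hg : LocallyLipschitz g) (hgc : g c = 0) (hf : ContinuousOn f (Icc a b))
    (hf' : ∀ s ∈ Ico a b, HasDerivWithinAt f (g (f s) * w s) (Ici s) s)
    (hw : ∀ s ∈ Ico a b, |w s| ≤ C) (ha : f a < c) : f b < c := by
  obtain ⟨K, hK⟩ := hg.locallyLipschitzOn.exists_lipschitzOnWith_of_compact
    ((isCompact_Icc.image_of_continuousOn hf).insert c)
  refine lt_of_abs_deriv_right_le (L := K * C) hab hf hf' (fun s hs => ?_) ha
  have hgs : |g (f s)| ≤ K * |f s - c| := by
    simpa [hgc, Real.norm_eq_abs] using hK.norm_sub_le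
      (mem_insert_of_mem c (mem_image_of_mem f (Ico_subset_Icc_self hs))) (mem_insert c _)
  calc |g (f s) * w s| = |g (f s)| * |w s| := abs_mul _ _
    _ ≤ K * |f s - c| * C := mul_le_mul hgs (hw s hs) (abs_nonneg _) (by positivity)
    _ = K * C * |f s - c| := mul_right_comm _ _ _

theorem lipschitzOnWith_Ici_of_norm_deriv_right_le {E : Type*} [NormedAddCommGroup E]
    [NormedSpace ℝ E] {f f' : ℝ → E} {a : ℝ} {C : NNReal} (hf : ContinuousOn f (Ici a))
    (hf' : ∀ s ≥ a, HasDerivWithinAt f (f' s) (Ici s) s) (hC : ∀ s ≥ a, ‖f' s‖ ≤ C) :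
    LipschitzOnWith C f (Ici a) := by
  refine LipschitzOnWith.of_dist_le_mul fun r hr s hs => ?_
  wlog hsr : s ≤ r generalizing r s
  · rw [dist_comm (f r), dist_comm r]
    exact this s hs r hr (le_of_not_ge hsr)
  rw [dist_eq_norm, Real.dist_eq, abs_of_nonneg (sub_nonneg.2 hsr)]
  exact norm_image_sub_le_of_norm_deriv_right_le_segment (hf.mono fun q hq => hs.trans hq.1)
    (fun q hq => hf' q (hs.trans hq.1)) (fun q hq => hC q (hs.trans hq.1)) r (right_mem_Icc.2 hsr)

theorem tendsto_sub_of_monotoneOn_of_bddAbove {η : ℝ → ℝ} {a : ℝ} (hη : MonotoneOn η (Ici a))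
    (hbdd : BddAbove (η '' Ici a)) (δ : ℝ) :
    Tendsto (fun s => η (s + δ) - η (s - δ)) atTop (𝓝 0) := by
  have hmono : Monotone fun s => η (max s a) := fun p q hpq =>
    hη (mem_Ici.2 (le_max_right p a)) (mem_Ici.2 (le_max_right q a)) (max_le_max_right a hpq)
  have hlim : Tendsto η atTop (𝓝 (⨆ s, η (max s a))) := by
    refine (tendsto_atTop_ciSup hmono (hbdd.mono ?_)).congr' ?_
    · exact range_subset_iff.2 fun s => mem_image_of_mem η (le_max_right s a)
    · filter_upwards [eventually_ge_atTop a] with s hs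
      rw [max_eq_left hs]
  simpa [sub_eq_add_neg] using (hlim.comp (tendsto_atTop_add_const_right _ δ tendsto_id)).sub
    (hlim.comp (tendsto_atTop_add_const_right _ (-δ) tendsto_id))

theorem sq_mul_le_image_sub_of_lipschitzOnWith {E : Type*} [NormedAddCommGroup E] {f : ℝ → E}
    {η : ℝ → ℝ} {p δ s ε : ℝ} {K : NNReal} (hf : LipschitzOnWith K f (Icc p (p + δ)))
    (hη : ContinuousOn η (Icc p (p + δ)))
    (hη' : ∀ r ∈ Ico p (p + δ), HasDerivWithinAt η (‖f r‖ ^ 2) (Ici r) r)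
    (hs : s ∈ Icc p (p + δ)) (hε : ε ≤ ‖f s‖) (hK : K * δ ≤ ε / 2) :
    (ε / 2) ^ 2 * δ ≤ η (p + δ) - η p := by
  have hδ : 0 ≤ δ := by linarith [hs.1, hs.2]
  have hε₀ : 0 ≤ ε / 2 := (by positivity : (0 : ℝ) ≤ K * δ).trans hK
  have hlarge : ∀ r ∈ Ico p (p + δ), (ε / 2) ^ 2 ≤ ‖f r‖ ^ 2 := fun r hr => by
    have hdist : ‖f s - f r‖ ≤ K * δ := by
      rw [← dist_eq_norm]
      refine (hf.dist_le_mul s hs r (Ico_subset_Icc_self hr)).trans ?_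
      gcongr
      exact abs_le.2 ⟨by linarith [hs.1, hr.2], by linarith [hs.2, hr.1]⟩
    have := norm_sub_norm_le (f s) (f r)
    gcongr
    linarith
  simpa using mul_sub_le_image_sub_of_le_deriv_right (by linarith) hη hη' hlarge

theorem hasDerivAt_mul_abs (y : ℝ) : HasDerivAt (fun r : ℝ => r * |r|) (2 * |y|) y := by
  rcases eq_or_ne y 0 with rfl | hy
  · rw [hasDerivAt_iff_tendsto_slope_zero]
    have habs : Tendsto (fun r : ℝ => |r|) (𝓝[≠] 0) (𝓝 0) := by
      simpa using (continuous_abs.tendsto (0 : ℝ)).mono_left nhdsWithin_le_nhds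
    simp only [abs_zero, mul_zero]
    refine habs.congr' ?_
    filter_upwards [self_mem_nhdsWithin] with r hr
    simp [inv_mul_cancel_left₀ hr]
  · refine ((hasDerivAt_id' y).mul (hasDerivAt_abs hy)).congr_deriv ?_
    rw [one_mul, self_mul_sign, two_mul]

theorem sq_sub_le_two_mul_abs_sub (x y : ℝ) : (x - y) ^ 2 ≤ 2 * |x * |x| - (y * |y|)| := by
  wlog hyx : y ≤ x generalizing x y
  · rw [← neg_sub, neg_sq, abs_sub_comm]
    exact this y x (le_of_not_ge hyx)
  refine le_trans ?_ (mul_le_mul_of_nonneg_left (le_abs_self _) zero_le_two)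
  rcases le_total 0 x with hx | hx <;> rcases le_total 0 y with hy | hy <;>
    simp only [abs_of_nonneg, abs_of_nonpos, hx, hy] <;> nlinarith [sq_nonneg (x + y)]

theorem tendsto_image_sub_of_tendsto_deriv_right {E : Type*} [NormedAddCommGroup E]
    [NormedSpace ℝ E] {f f' : ℝ → E} {ρ : ℝ → ℝ} {a W : ℝ} (hf : ContinuousOn f (Ici a))
    (hf' : ∀ s ≥ a, HasDerivWithinAt f (f' s) (Ici s) s) (hlim : Tendsto f' atTop (𝓝 0))
    (hρ : ∀ᶠ s in atTop, s ≤ ρ s ∧ ρ s ≤ s + W) :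
    Tendsto (fun s => f (ρ s) - f s) atTop (𝓝 0) := by
  rw [Metric.tendsto_nhds]
  intro ε hε
  have hδ : 0 < ε / (|W| + 1) := by positivity
  obtain ⟨s₀, hs₀⟩ := ((hlim.norm.eventually_le_const (by simpa using hδ)).and
    (eventually_ge_atTop a)).exists_forall_of_atTop
  filter_upwards [hρ, eventually_ge_atTop s₀] with s ⟨hs, hsW⟩ hs₀s
  have hmvt := norm_image_sub_le_of_norm_deriv_right_le_segment
    (hf.mono fun r hr => (hs₀ r (hs₀s.trans hr.1)).2)
    (fun r hr => hf' r (hs₀ r (hs₀s.trans hr.1)).2) (fun r hr => (hs₀ r (hs₀s.trans hr.1)).1)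
    (ρ s) (right_mem_Icc.2 hs)
  rw [dist_zero_right]
  calc ‖f (ρ s) - f s‖ ≤ ε / (|W| + 1) * (ρ s - s) := hmvt
    _ ≤ ε / (|W| + 1) * |W| := by gcongr; linarith [le_abs_self W]
    _ < ε := by rw [div_mul_eq_mul_div, div_lt_iff₀ (by positivity)]; linarith

/- The signed square `x |x|` has derivative `2 |x| x'`, and unlike `x ^ 2` it determines `x`. -/
theorem tendsto_image_sub_of_tendsto_mul_deriv_right {x x' ρ : ℝ → ℝ} {a W : ℝ}
    (hx : ContinuousOn x (Ici a)) (hx' : ∀ s ≥ a, HasDerivWithinAt x (x' s) (Ici s) s)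
    (hlim : Tendsto (fun s => x s * x' s) atTop (𝓝 0))
    (hρ : ∀ᶠ s in atTop, s ≤ ρ s ∧ ρ s ≤ s + W) :
    Tendsto (fun s => x (ρ s) - x s) atTop (𝓝 0) := by
  have hlim' : Tendsto (fun s => 2 * |x s| * x' s) atTop (𝓝 0) := by
    refine squeeze_zero_norm (fun s => ?_) (by simpa using (hlim.norm.const_mul 2))
    simp [mul_assoc]
  have hsq : Tendsto (fun s => x (ρ s) * |x (ρ s)| - x s * |x s|) atTop (𝓝 0) :=
    tendsto_image_sub_of_tendsto_deriv_right (hx.mul hx.abs)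
      (fun s hs => (hasDerivAt_mul_abs (x s)).comp_hasDerivWithinAt s (hx' s hs)) hlim' hρ
  refine squeeze_zero_norm (fun s => Real.abs_le_sqrt (sq_sub_le_two_mul_abs_sub _ _)) ?_
  simpa using (hsq.norm.const_mul 2).sqrt

end RightDeriv

theorem exists_gt_mul_cos_eq (m y : ℝ) : ∃ c > m, c * Real.cos c = y := by
  obtain ⟨k, hk⟩ := exists_nat_gt (max m |y|)
  have hm : m < k := (le_max_left _ _).trans_lt hk
  have hy := abs_le.1 ((le_max_right _ _).trans hk.le)
  have hπ := Real.pi_gt_three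
  set p : ℝ := k * (2 * Real.pi)
  have hkp : (k : ℝ) ≤ p := by nlinarith [k.cast_nonneg (α := ℝ)]
  have hcos : Real.cos p = 1 := Real.cos_nat_mul_two_pi k
  obtain ⟨c, hc, hcy⟩ : y ∈ (fun c => c * Real.cos c) '' Icc p (p + Real.pi) := by
    refine intermediate_value_Icc' (by linarith) (by fun_prop) ⟨?_, ?_⟩
    · simp only [Real.cos_add_pi, hcos]; linarith
    · simp only [hcos]; linarith
  exact ⟨c, by linarith [hc.1], hcy⟩

/-- Switching times `0 = t 0 < t 1 < ⋯` with a positive dwell time. -/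
structure IsSwitchingTimes (t : ℕ → ℝ) : Prop where
  start : t 0 = 0
  dwell : ∃ τ : ℝ, 0 < τ ∧ ∀ j, τ < t (j + 1) - t j

namespace IsSwitchingTimes

variable {t : ℕ → ℝ}

theorem strictMono (ht : IsSwitchingTimes t) : StrictMono t := by
  obtain ⟨τ, hτ, hdwell⟩ := ht.dwell
  exact strictMono_nat_of_lt_succ fun j => by linarith [hdwell j]

theorem nonneg (ht : IsSwitchingTimes t) (j : ℕ) : 0 ≤ t j :=
  ht.start ▸ ht.strictMono.monotone j.zero_le

theorem tendsto_atTop (ht : IsSwitchingTimes t) : Tendsto t atTop atTop := by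
  obtain ⟨τ, hτ, hdwell⟩ := ht.dwell
  refine tendsto_atTop_mono (fun j => ?_) (tendsto_natCast_atTop_atTop.atTop_mul_const hτ)
  induction j with
  | zero => simp [ht.start]
  | succ j ih => push_cast; linarith [hdwell j]

theorem iUnion_Ico (ht : IsSwitchingTimes t) : ⋃ j, Ico (t j) (t (j + 1)) = Ici 0 := by
  simpa [ht.start] using iUnion_Ico_map_succ_eq_Ici (f := t)
    (fun j => ht.strictMono.monotone j.zero_le) (not_bddAbove_of_tendsto_atTop ht.tendsto_atTop)

theorem exists_mem_Ico (ht : IsSwitchingTimes t) {s : ℝ} (hs : 0 ≤ s) :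
    ∃ j, s ∈ Ico (t j) (t (j + 1)) :=
  mem_iUnion.1 (ht.iUnion_Ico.ge hs)

theorem exists_mem_Ioo (ht : IsSwitchingTimes t) {s : ℝ} (hs : 0 ≤ s) (hst : s ∉ range t) :
    ∃ j, s ∈ Ioo (t j) (t (j + 1)) :=
  let ⟨j, hj⟩ := ht.exists_mem_Ico hs
  ⟨j, hj.1.lt_of_ne fun h => hst ⟨j, h⟩, hj.2⟩

theorem eq_of_mem_Ico (ht : IsSwitchingTimes t) {s : ℝ} {j k : ℕ}
    (hj : s ∈ Ico (t j) (t (j + 1))) (hk : s ∈ Ico (t k) (t (k + 1))) : j = k := by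
  have hjk := ht.strictMono.lt_iff_lt.1 (hj.1.trans_lt hk.2)
  have hkj := ht.strictMono.lt_iff_lt.1 (hk.1.trans_lt hj.2)
  lia

theorem notMem_range_of_mem_Ioo (ht : IsSwitchingTimes t) {s : ℝ} {j : ℕ}
    (hs : s ∈ Ioo (t j) (t (j + 1))) : s ∉ range t := by
  rintro ⟨k, rfl⟩
  have hjk := ht.strictMono.lt_iff_lt.1 hs.1
  have hkj := ht.strictMono.lt_iff_lt.1 hs.2
  lia

theorem continuousOn_Ici {E : Type*} [TopologicalSpace E] (ht : IsSwitchingTimes t) {z : ℝ → E}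
    (hz : ∀ j, ContinuousOn z (Icc (t j) (t (j + 1)))) : ContinuousOn z (Ici 0) := by
  have hfin : LocallyFinite fun j => Icc (t j) (t (j + 1)) := fun s => by
    obtain ⟨k, hk⟩ := (ht.tendsto_atTop.eventually_gt_atTop s).exists
    exact ⟨Iio (t k), Iio_mem_nhds hk, (finite_Iio k).subset fun j ⟨r, hrj, hrk⟩ =>
      ht.strictMono.lt_iff_lt.1 (hrj.1.trans_lt hrk)⟩
  refine (hfin.continuousOn_iUnion (fun _ => isClosed_Icc) hz).mono ?_
  rw [← ht.iUnion_Ico]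
  exact iUnion_mono fun _ => Ico_subset_Icc_self

theorem exists_eqOn_Icc {E : Type*} (ht : IsSwitchingTimes t) (φ : ℕ → ℝ → E)
    (hφ : ∀ j, φ j (t (j + 1)) = φ (j + 1) (t (j + 1))) :
    ∃ z : ℝ → E, ∀ j, EqOn z (φ j) (Icc (t j) (t (j + 1))) := by
  choose! J hJ using fun s (hs : 0 ≤ s) => ht.exists_mem_Ico hs
  have hJ_eq {j : ℕ} {s : ℝ} (hs : s ∈ Ico (t j) (t (j + 1))) : J s = j :=
    ht.eq_of_mem_Ico (hJ s ((ht.nonneg j).trans hs.1)) hs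
  refine ⟨fun s => φ (J s) s, fun j s hs => ?_⟩
  rcases hs.2.eq_or_lt with rfl | hlt
  · simp only [hJ_eq (left_mem_Ico.2 (ht.strictMono (j + 1).lt_succ_self)), hφ]
  · simp only [hJ_eq ⟨hs.1, hlt⟩]

theorem exists_Icc_subset_Ico (ht : IsSwitchingTimes t) :
    ∃ δ₀ > 0, ∀ δ ∈ Icc 0 δ₀, ∀ s ≥ 0,
      ∃ j, ∃ p ∈ Icc (s - δ) s, Icc p (p + δ) ⊆ Ico (t j) (t (j + 1)) := by
  obtain ⟨τ, hτ, hdwell⟩ := ht.dwell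
  refine ⟨τ / 2, half_pos hτ, fun δ ⟨hδ, hδτ⟩ s hs => ?_⟩
  obtain ⟨j, hj⟩ := ht.exists_mem_Ico hs
  refine ⟨j, ?_⟩
  rcases lt_or_ge (s + δ) (t (j + 1)) with hlt | hge
  · exact ⟨s, ⟨by linarith, le_rfl⟩, fun r hr => ⟨hj.1.trans hr.1, hr.2.trans_lt hlt⟩⟩
  · refine ⟨s - δ, ⟨le_rfl, by linarith⟩, fun r hr => ⟨?_, ?_⟩⟩
    · linarith [hdwell j, hr.1]
    · linarith [hj.2, hr.2]

/- Barbalat's lemma with switching: as there is a dwell time, every time lies in a window of fixed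
length on which `f` is Lipschitz, and `η` grows by a fixed amount on it if `‖f‖` is not small. -/
theorem tendsto_zero_of_lipschitzOnWith (ht : IsSwitchingTimes t) {E : Type*}
    [NormedAddCommGroup E] {f : ℝ → E} {η : ℝ → ℝ} {K : NNReal}
    (hf : ∀ j, LipschitzOnWith K f (Ico (t j) (t (j + 1)))) (hη : ContinuousOn η (Ici 0))
    (hη' : ∀ s ≥ 0, HasDerivWithinAt η (‖f s‖ ^ 2) (Ici s) s) (hbdd : BddAbove (η '' Ici 0)) :
    Tendsto f atTop (𝓝 0) := by
  obtain ⟨δ₀, hδ₀, hwindow⟩ := ht.exists_Icc_subset_Ico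
  have hmono : MonotoneOn η (Ici 0) := fun p hp q _ hpq =>
    image_le_image_of_deriv_right_nonneg hpq (hη.mono fun s hs => hp.trans hs.1)
      (fun s hs => hη' s (hp.trans hs.1)) fun s _ => sq_nonneg ‖f s‖
  rw [Metric.tendsto_nhds]
  intro ε hε
  obtain ⟨δ, hδ, hδδ₀, hδK⟩ : ∃ δ > 0, δ ≤ δ₀ ∧ K * δ ≤ ε / 2 := by
    refine ⟨min δ₀ (ε / 2 / (K + 1)), by positivity, min_le_left _ _, ?_⟩
    calc K * min δ₀ (ε / 2 / (K + 1)) ≤ (K + 1) * (ε / 2 / (K + 1)) := by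
          gcongr
          · simp
          · exact min_le_right _ _
      _ = ε / 2 := by field_simp
  have hincr := (tendsto_sub_of_monotoneOn_of_bddAbove hmono hbdd δ).eventually_lt_const
    (show 0 < (ε / 2) ^ 2 * δ by positivity)
  filter_upwards [hincr, eventually_ge_atTop δ] with s hs hsδ
  rw [dist_zero_right]
  by_contra! hfs
  obtain ⟨j, p, ⟨hsp, hps⟩, hpj⟩ := hwindow δ ⟨hδ.le, hδδ₀⟩ s (hδ.le.trans hsδ)
  have hp₀ : 0 ≤ p := by linarith
  have h₁ := hmono (mem_Ici.2 (by linarith)) (mem_Ici.2 hp₀) hsp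
  have h₂ := sq_mul_le_image_sub_of_lipschitzOnWith ((hf j).mono hpj)
    (hη.mono fun r hr => hp₀.trans hr.1) (fun r hr => hη' r (hp₀.trans hr.1))
    ⟨hps, by linarith⟩ hfs hδK
  have h₃ := hmono (mem_Ici.2 (by linarith)) (mem_Ici.2 (by linarith)) (add_le_add_left hps δ)
  linarith

end IsSwitchingTimes

/-- A switching signal with finitely many values: `σ` is constant between consecutive switching
times. Its values at negative times play no role. -/
structure IsSwitchingSignal {ι : Type*} (t : ℕ → ℝ) (σ : ℝ → ι) : Prop extends
    IsSwitchingTimes t where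
  const : ∀ j, ∀ s ∈ Ico (t j) (t (j + 1)), σ s = σ (t j)
  finite : (σ '' Ici 0).Finite

namespace IsSwitchingSignal

variable {ι : Type*} {t : ℕ → ℝ} {σ : ℝ → ι}

theorem exists_forall_norm_le (hσ : IsSwitchingSignal t σ) {V E : Type*} [TopologicalSpace V]
    [NormedAddCommGroup E] {Φ : ι → V → E} (hΦ : ∀ i, Continuous (Φ i)) {K : Set V}
    (hK : IsCompact K) : ∃ C : NNReal, ∀ s ≥ 0, ∀ v ∈ K, ‖Φ (σ s) v‖ ≤ C := by
  have hbound : ∀ᶠ C : NNReal in atTop, ∀ i ∈ σ '' Ici 0, ∀ v ∈ K, ‖Φ i v‖ ≤ C := by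
    refine (eventually_all_finite hσ.finite).2 fun i _ => ?_
    obtain ⟨C, hC⟩ := hK.exists_bound_of_continuousOn (hΦ i).continuousOn
    filter_upwards [eventually_ge_atTop C.toNNReal] with D hD v hv
    exact (hC v hv).trans (Real.toNNReal_le_iff_le_coe.1 hD)
  obtain ⟨C, hC⟩ := hbound.exists
  exact ⟨C, fun s hs => hC _ (mem_image_of_mem σ hs)⟩

theorem exists_forall_lipschitzOnWith (hσ : IsSwitchingSignal t σ) {V E : Type*}
    [PseudoMetricSpace V] [PseudoMetricSpace E] {Φ : ι → V → E} (hΦ : ∀ i, LocallyLipschitz (Φ i))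
    {K : Set V} (hK : IsCompact K) : ∃ C, ∀ s ≥ 0, LipschitzOnWith C (Φ (σ s)) K := by
  have hbound : ∀ᶠ C in atTop, ∀ i ∈ σ '' Ici 0, LipschitzOnWith C (Φ i) K := by
    refine (eventually_all_finite hσ.finite).2 fun i _ => ?_
    obtain ⟨C, hC⟩ := (hΦ i).locallyLipschitzOn.exists_lipschitzOnWith_of_compact hK
    filter_upwards [eventually_ge_atTop C] with D hD using hC.weaken hD
  obtain ⟨C, hC⟩ := hbound.exists
  exact ⟨C, fun s hs => hC _ (mem_image_of_mem σ hs)⟩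

section Integral

open MeasureTheory

variable {V E : Type*} [TopologicalSpace V] [NormedAddCommGroup E]
  {Φ : ι → V → E} {x : ℝ → V} {T : ℝ}

theorem intervalIntegrable (hσ : IsSwitchingSignal t σ) (hΦ : ∀ i, Continuous (Φ i))
    (hT : 0 ≤ T) (hx : ContinuousOn x (Icc 0 T)) :
    IntervalIntegrable (fun s => Φ (σ s) (x s)) volume 0 T := by
  have hle (j : ℕ) : min (t j) T ≤ min (t (j + 1)) T :=
    min_le_min_right T (hσ.strictMono j.lt_succ_self).le
  have hpiece (j : ℕ) : IntervalIntegrable (fun s => Φ (σ s) (x s)) volume (min (t j) T)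
      (min (t (j + 1)) T) := by
    have hcont :
        ContinuousOn (fun s => Φ (σ (t j)) (x s)) (Icc (min (t j) T) (min (t (j + 1)) T)) :=
      (hΦ _).comp_continuousOn (hx.mono (Icc_subset_Icc (le_min (hσ.nonneg j) hT)
        (min_le_right _ _)))
    refine (hcont.intervalIntegrable_of_Icc (hle j)).congr_uIoo fun s hs => ?_
    rw [uIoo_of_le (hle j)] at hs
    have hsT : s < T := hs.2.trans_le (min_le_right _ _)
    simp only [hσ.const j s ⟨(min_lt_iff.1 hs.1).resolve_right hsT.not_gt |>.le,
      hs.2.trans_le (min_le_left _ _)⟩]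
  obtain ⟨k, hk⟩ := (hσ.tendsto_atTop.eventually_ge_atTop T).exists
  simpa [hσ.start, hT, hk] using IntervalIntegrable.trans_iterate (n := k) fun j _ => hpiece j

theorem continuousOn_integral [NormedSpace ℝ E] (hσ : IsSwitchingSignal t σ)
    (hΦ : ∀ i, Continuous (Φ i)) (hT : 0 ≤ T) (hx : ContinuousOn x (Icc 0 T)) :
    ContinuousOn (fun r => ∫ s in (0 : ℝ)..r, Φ (σ s) (x s)) (Icc 0 T) := by
  simpa [uIcc_of_le hT] using intervalIntegral.continuousOn_primitive_interval'
    (hσ.intervalIntegrable hΦ hT hx) left_mem_uIcc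

theorem hasDerivAt_integral [NormedSpace ℝ E] [CompleteSpace E]
    (hσ : IsSwitchingSignal t σ) (hΦ : ∀ i, Continuous (Φ i)) (hx : ContinuousOn x (Icc 0 T))
    {s : ℝ} (hs : s ∈ Ioo 0 T) (hst : s ∉ range t) :
    HasDerivAt (fun r => ∫ q in (0 : ℝ)..r, Φ (σ q) (x q)) (Φ (σ s) (x s)) s := by
  obtain ⟨j, hj⟩ := hσ.exists_mem_Ioo hs.1.le hst
  have hopen : IsOpen (Ioo (t j) (t (j + 1)) ∩ Ioo 0 T) := isOpen_Ioo.inter isOpen_Ioo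
  have hcont : ContinuousOn (fun r => Φ (σ r) (x r)) (Ioo (t j) (t (j + 1)) ∩ Ioo 0 T) := by
    refine ((hΦ (σ (t j))).comp_continuousOn
      (hx.mono (inter_subset_right.trans Ioo_subset_Icc_self))).congr fun r hr => ?_
    rw [hσ.const j r (Ioo_subset_Ico_self hr.1), Function.comp_apply]
  exact intervalIntegral.integral_hasDerivAt_right
    (hσ.intervalIntegrable hΦ hs.1.le (hx.mono (Icc_subset_Icc_right hs.2.le)))
    (hcont.stronglyMeasurableAtFilter hopen s ⟨hj, hs⟩)
    (hcont.continuousAt (hopen.mem_nhds ⟨hj, hs⟩))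

end Integral

end IsSwitchingSignal

/-- `z` solves `z' = F (σ s) z` on the time interval `I`: it is continuous on `I` and satisfies the
equation at every interior time that is not a switching time. -/
structure IsSwitchedSolution {ι E : Type*} [NormedAddCommGroup E] [NormedSpace ℝ E]
    (F : ι → E → E) (t : ℕ → ℝ) (σ : ℝ → ι) (I : Set ℝ) (z : ℝ → E) : Prop where
  continuousOn : ContinuousOn z I
  hasDerivAt : ∀ s ∈ interior I, s ∉ range t → HasDerivAt z (F (σ s) (z s)) s

namespace IsSwitchedSolution

variable {ι E : Type*} [NormedAddCommGroup E] [NormedSpace ℝ E] {F : ι → E → E} {t : ℕ → ℝ}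
  {σ : ℝ → ι} {I : Set ℝ} {z w : ℝ → E}

theorem mono {J : Set ℝ} (h : IsSwitchedSolution F t σ I z) (hJ : J ⊆ I) :
    IsSwitchedSolution F t σ J z :=
  ⟨h.continuousOn.mono hJ, fun s hs => h.hasDerivAt s (interior_mono hJ hs)⟩

theorem Ici_of_forall_Icc (h : ∀ T ≥ 0, IsSwitchedSolution F t σ (Icc 0 T) z) :
    IsSwitchedSolution F t σ (Ici 0) z where
  continuousOn s hs := by
    refine ((h (s + 1) (add_nonneg hs zero_le_one)).continuousOn s
      ⟨hs, by linarith⟩).mono_of_mem_nhdsWithin ?_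
    rw [← Ici_inter_Iic]
    exact inter_mem_nhdsWithin _ (Iic_mem_nhds (lt_add_one s))
  hasDerivAt s hs := by
    rw [interior_Ici, mem_Ioi] at hs
    exact (h (s + 1) (by linarith)).hasDerivAt s (interior_Icc.ge ⟨hs, lt_add_one s⟩)

theorem hasDerivWithinAt_Ici (hσ : IsSwitchingSignal t σ) (hF : ∀ i, Continuous (F i))
    (h : IsSwitchedSolution F t σ I z) {s : ℝ} (hs : 0 ≤ s) (hI : I ∈ 𝓝[≥] s) :
    HasDerivWithinAt z (F (σ s) (z s)) (Ici s) s := by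
  have hzs : ContinuousWithinAt z (Ici s) s :=
    (h.continuousOn s (mem_of_mem_nhdsWithin self_mem_Ici hI)).mono_of_mem_nhdsWithin hI
  obtain ⟨j, hj⟩ := hσ.exists_mem_Ico hs
  obtain ⟨u, hu, hsub⟩ :=
    mem_nhdsGE_iff_exists_Ico_subset.1 (inter_mem hI (Ico_mem_nhdsGE_of_mem hj))
  have hderiv : ∀ r ∈ Ioo s u, HasDerivAt z (F (σ s) (z r)) r := fun r hr => by
    have hrj : r ∈ Ico (t j) (t (j + 1)) := (hsub (Ioo_subset_Ico_self hr)).2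
    have hrI : r ∈ interior I := mem_interior_iff_mem_nhds.2 <| mem_of_superset
      (Ioo_mem_nhds hr.1 hr.2) fun q hq => (hsub (Ioo_subset_Ico_self hq)).1
    have := h.hasDerivAt r hrI (hσ.notMem_range_of_mem_Ioo ⟨hj.1.trans_lt hr.1, hrj.2⟩)
    rwa [hσ.const j r hrj, ← hσ.const j s hj] at this
  refine hasDerivWithinAt_Ici_of_tendsto_deriv (s := Ioo s u)
    (fun r hr => (hderiv r hr).differentiableAt.differentiableWithinAt)
    (hzs.mono fun r hr => hr.1.le) (Ioo_mem_nhdsGT hu) ?_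
  have hlim : Tendsto (fun r => F (σ s) (z r)) (𝓝[>] s) (𝓝 (F (σ s) (z s))) :=
    ((hF (σ s)).tendsto (z s)).comp (hzs.mono_left (nhdsWithin_mono s Ioi_subset_Ici_self))
  refine hlim.congr' ?_
  filter_upwards [Ioo_mem_nhdsGT hu] with r hr using (hderiv r hr).deriv.symm

theorem eqOn_Icc (hσ : IsSwitchingSignal t σ) (hF : ∀ i, LocallyLipschitz (F i)) {T : ℝ}
    (hz : IsSwitchedSolution F t σ (Icc 0 T) z) (hw : IsSwitchedSolution F t σ (Icc 0 T) w)
    (h₀ : z 0 = w 0) : EqOn z w (Icc 0 T) := by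
  obtain ⟨C, hC⟩ := hσ.exists_forall_lipschitzOnWith hF
    ((isCompact_Icc.image_of_continuousOn hz.continuousOn).union
      (isCompact_Icc.image_of_continuousOn hw.continuousOn))
  have hcont (i : ι) : Continuous (F i) := (hF i).continuous
  exact ODE_solution_unique_of_mem_Icc_right (fun s hs => hC s hs.1)
    hz.continuousOn (fun s hs => hz.hasDerivWithinAt_Ici hσ hcont hs.1 (Icc_mem_nhdsGE_of_mem hs))
    (fun s hs => .inl (mem_image_of_mem z (Ico_subset_Icc_self hs)))
    hw.continuousOn (fun s hs => hw.hasDerivWithinAt_Ici hσ hcont hs.1 (Icc_mem_nhdsGE_of_mem hs))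
    (fun s hs => .inr (mem_image_of_mem w (Ico_subset_Icc_self hs))) h₀

theorem exists_lipschitzOnWith_comp (hσ : IsSwitchingSignal t σ) (hF : ∀ i, Continuous (F i))
    (hz : IsSwitchedSolution F t σ (Ici 0) z) {K : Set E} (hK : IsCompact K)
    (hzK : MapsTo z (Ici 0) K) {V : Type*} [PseudoMetricSpace V] {Φ : ι → E → V}
    (hΦ : ∀ i, LocallyLipschitz (Φ i)) :
    ∃ C, ∀ j, LipschitzOnWith C (fun s => Φ (σ s) (z s)) (Ico (t j) (t (j + 1))) := by
  obtain ⟨B, hB⟩ := hσ.exists_forall_norm_le hF hK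
  obtain ⟨C, hC⟩ := hσ.exists_forall_lipschitzOnWith hΦ hK
  have hzB : LipschitzOnWith B z (Ici 0) :=
    lipschitzOnWith_Ici_of_norm_deriv_right_le hz.continuousOn
      (fun s hs => hz.hasDerivWithinAt_Ici hσ hF hs
        (mem_of_superset self_mem_nhdsWithin (Ici_subset_Ici.2 hs)))
      fun s hs => hB s hs _ (hzK hs)
  refine ⟨C * B, fun j r hr s hs => ?_⟩
  have hj : Ico (t j) (t (j + 1)) ⊆ Ici 0 := fun q hq => (hσ.nonneg j).trans hq.1
  simp only [hσ.const j r hr, hσ.const j s hs]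
  exact (hC (t j) (hσ.nonneg j)).comp (hzB.mono hj) (hzK.mono_left hj) hr hs

theorem integral_clm_comp (hσ : IsSwitchingSignal t σ) (hF : ∀ i, Continuous (F i)) {T : ℝ}
    (hT : 0 ≤ T) (hz : IsSwitchedSolution F t σ (Icc 0 T) z) {V : Type*} [NormedAddCommGroup V]
    [NormedSpace ℝ V] [CompleteSpace V] (φ : E →L[ℝ] V) :
    ∫ s in (0 : ℝ)..T, φ (F (σ s) (z s)) = φ (z T) - φ (z 0) := by
  refine intervalIntegral.integral_eq_sub_of_hasDeriv_right_of_le hT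
    (φ.continuous.comp_continuousOn hz.continuousOn) (fun s hs => ?_)
    (hσ.intervalIntegrable (fun i => φ.continuous.comp (hF i)) hT hz.continuousOn)
  exact (φ.hasFDerivAt.comp_hasDerivWithinAt s (hz.hasDerivWithinAt_Ici hσ hF hs.1.le
    (Icc_mem_nhdsGE_of_mem (Ioo_subset_Ico_self hs)))).mono Ioi_subset_Ici_self

end IsSwitchedSolution

theorem exists_hasDerivWithinAt_Icc_of_lipschitzWith {E : Type*} [NormedAddCommGroup E]
    [NormedSpace ℝ E] [CompleteSpace E] {f : E → E} {K : NNReal} (hf : LipschitzWith K f) {L : ℝ}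
    (hL : ∀ v, ‖f v‖ ≤ L) {a b : ℝ} (hab : a ≤ b) (v : E) :
    ∃ z : ℝ → E, z a = v ∧ ∀ s ∈ Icc a b, HasDerivWithinAt z (f (z s)) (Icc a b) s := by
  lift L to NNReal using (norm_nonneg _).trans (hL v)
  lift b - a to NNReal using sub_nonneg.2 hab with d hd
  refine (IsPicardLindelof.of_time_independent (t₀ := ⟨a, left_mem_Icc.2 hab⟩) (a := L * d)
    (r := 0) (fun w _ => hL w) hf.lipschitzOnWith ?_).exists_eq_forall_mem_Icc_hasDerivWithinAt₀
  simp [← hd]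

theorem exists_isSwitchedSolution_Ici {ι E : Type*} [NormedAddCommGroup E] [NormedSpace ℝ E]
    [CompleteSpace E] {F : ι → E → E} {t : ℕ → ℝ} {σ : ℝ → ι} (hσ : IsSwitchingSignal t σ)
    (hF : ∀ i, ∃ K, LipschitzWith K (F i)) (hL : ∀ i, ∃ L, ∀ v, ‖F i v‖ ≤ L) (z₀ : E) :
    ∃ z, IsSwitchedSolution F t σ (Ici 0) z ∧ z 0 = z₀ := by
  have hle (j : ℕ) : t j ≤ t (j + 1) := (hσ.strictMono j.lt_succ_self).le
  have hpiece (j : ℕ) (v : E) : ∃ φ : ℝ → E, φ (t j) = v ∧ ∀ s ∈ Icc (t j) (t (j + 1)),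
      HasDerivWithinAt φ (F (σ (t j)) (φ s)) (Icc (t j) (t (j + 1))) s :=
    let ⟨_, hK⟩ := hF (σ (t j))
    let ⟨_, hL⟩ := hL (σ (t j))
    exists_hasDerivWithinAt_Icc_of_lipschitzWith hK hL (hle j) v
  choose φ hφ₀ hφ using hpiece
  let v (j : ℕ) : E := Nat.rec z₀ (fun j v => φ j v (t (j + 1))) j
  obtain ⟨z, hz⟩ := hσ.exists_eqOn_Icc (fun j => φ j (v j)) fun j => (hφ₀ (j + 1) (v (j + 1))).symm
  have hz' (j : ℕ) {s : ℝ} (hs : s ∈ Icc (t j) (t (j + 1))) :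
      HasDerivWithinAt z (F (σ (t j)) (z s)) (Icc (t j) (t (j + 1))) s := by
    rw [hz j hs]
    exact (hφ j (v j) s hs).congr (hz j) (hz j hs)
  refine ⟨z, ⟨hσ.continuousOn_Ici fun j s hs => (hz' j hs).continuousWithinAt, ?_⟩, ?_⟩
  · intro s hs hst
    obtain ⟨j, hj⟩ := hσ.exists_mem_Ioo (interior_subset hs) hst
    rw [hσ.const j s (Ioo_subset_Ico_self hj)]
    exact (hz' j (Ioo_subset_Icc_self hj)).hasDerivAt (Icc_mem_nhds hj.1 hj.2)
  · have h₀ := (hz 0 (left_mem_Icc.2 (hle 0))).trans (hφ₀ 0 (v 0))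
    rwa [hσ.start] at h₀

/- The a priori bound is asked for all cut-offs of `F`, as the solution is first constructed for a
compactly supported one; the bound then shows that it never leaves the region where the cut-off
is `1`. -/
theorem exists_isSwitchedSolution_Ici_of_norm_le {ι E : Type*} [NormedAddCommGroup E]
    [NormedSpace ℝ E] [FiniteDimensional ℝ E] {F : ι → E → E} {t : ℕ → ℝ} {σ : ℝ → ι}
    (hσ : IsSwitchingSignal t σ) (hF : ∀ i, ContDiff ℝ 1 (F i)) {z₀ : E} {R : ℝ}
    (hR : ∀ β : E → ℝ, Continuous β → (∀ v, β v ∈ Icc 0 1) → ∀ T ≥ 0, ∀ z,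
      IsSwitchedSolution (fun i v => β v • F i v) t σ (Icc 0 T) z → z 0 = z₀ → ‖z T‖ ≤ R) :
    ∃ z, IsSwitchedSolution F t σ (Ici 0) z ∧ z 0 = z₀ := by
  let β : ContDiffBump (0 : E) :=
    ⟨max R 1, max R 1 + 1, lt_max_of_lt_right one_pos, lt_add_one _⟩
  have hsmooth (i : ι) : ContDiff ℝ 1 fun v => β v • F i v := β.contDiff.smul (hF i)
  have hsupp (i : ι) : HasCompactSupport fun v => β v • F i v := β.hasCompactSupport.smul_right
  obtain ⟨z, hz, hz₀⟩ := exists_isSwitchedSolution_Ici hσ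
    (fun i => (hsmooth i).lipschitzWith_of_hasCompactSupport (hsupp i) one_ne_zero)
    (fun i => (hsupp i).exists_bound_of_continuous (hsmooth i).continuous) z₀
  have hβz : ∀ s ≥ 0, β (z s) = 1 := fun s hs => by
    refine β.one_of_mem_closedBall (mem_closedBall_zero_iff.2 (le_max_of_le_left ?_))
    exact hR β β.continuous (fun v => ⟨β.nonneg, β.le_one⟩) s hs z
      (hz.mono Icc_subset_Ici_self) hz₀
  refine ⟨z, ⟨hz.continuousOn, fun s hs hst => ?_⟩, hz₀⟩
  simpa only [hβz s (interior_subset hs), one_smul] using hz.hasDerivAt s hs hst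

section Graph

variable {N M : ℕ}

theorem WeightedDigraph.laplacian_mulVec_apply (g : WeightedDigraph N) (v : Fin N → ℝ)
    (i : Fin N) : (g.laplacian *ᵥ v) i = ∑ k, g.A i k * (v i - v k) := by
  rw [WeightedDigraph.laplacian, Matrix.sub_mulVec, Pi.sub_apply, Matrix.mulVec_diagonal]
  simp only [mul_sub, Finset.sum_sub_distrib, Finset.sum_mul, Matrix.mulVec, dotProduct]

@[fun_prop]
theorem WeightedDigraph.contDiff_laplacian_mulVec {E : Type*} [NormedAddCommGroup E]
    [NormedSpace ℝ E] (g : WeightedDigraph N) {f : E → Fin N → ℝ} {k : WithTop ℕ∞}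
    (hf : ContDiff ℝ k f) (i : Fin N) : ContDiff ℝ k fun v => (g.laplacian *ᵥ f v) i := by
  simp only [g.laplacian_mulVec_apply]
  fun_prop

theorem relErr_eq_laplacian_mulVec (Gt : ℝ → WeightedDigraph N) (x : ℝ → Fin N → ℝ) (i : Fin N)
    (s : ℝ) : relErr Gt x i s = ((Gt s).laplacian *ᵥ x s) i :=
  ((Gt s).laplacian_mulVec_apply (x s) i).symm

theorem WeightedDigraph.eq_of_edge_of_mul_laplacian_mulVec_eq_zero {g : WeightedDigraph N}
    {c : Fin N → ℝ} {p q : Fin N} (hpq : g.Edge p q) (hq : c q * (g.laplacian *ᵥ c) q = 0)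
    (hmax : ∀ k, |c k| ≤ |c q|) : c p = c q := by
  have hnonneg (k : Fin N) : 0 ≤ c q * (c q - c k) := by
    have hle := (le_abs_self (c q * c k)).trans ((abs_mul _ _).trans_le
      (mul_le_mul_of_nonneg_left (hmax k) (abs_nonneg _)))
    rw [abs_mul_abs_self] at hle
    linarith
  rw [g.laplacian_mulVec_apply, Finset.mul_sum] at hq
  simp only [mul_left_comm (c q)] at hq
  have hzero := (Finset.sum_eq_zero_iff_of_nonneg fun k _ =>
    mul_nonneg (g.nonneg q k) (hnonneg k)).1 hq p (Finset.mem_univ p)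
  rcases mul_eq_zero.1 ((mul_eq_zero.1 hzero).resolve_left hpq.ne') with hcq | hcq
  · rw [hcq, ← abs_nonpos_iff]
    simpa [hcq] using hmax p
  · exact (sub_eq_zero.1 hcq).symm

-- The value at a node of maximal modulus propagates backwards along every edge of the union.
theorem HasJointlyStronglyConnectedBasis.eq_of_mul_laplacian_mulVec_eq_zero
    {G : Fin M → WeightedDigraph N} (hG : HasJointlyStronglyConnectedBasis G) {c : Fin N → ℝ}
    (hc : ∀ ℓ i, c i * ((G ℓ).laplacian *ᵥ c) i = 0) (i k : Fin N) : c i = c k := by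
  have : Nonempty (Fin N) := ⟨i⟩
  obtain ⟨m, hm⟩ := Finite.exists_max fun j => |c j|
  have hback {p q : Fin N} (hpq : basisUnionEdge G p q) (hq : c q = c m) : c p = c m := by
    obtain ⟨ℓ, S, -, -, -, hedge⟩ := hpq
    exact (WeightedDigraph.eq_of_edge_of_mul_laplacian_mulVec_eq_zero hedge (hc ℓ q)
      (by simpa only [hq] using hm)).trans hq
  have hall (u : Fin N) : c u = c m := by
    rcases eq_or_ne u m with rfl | hum
    · rfl
    have hpath := hG.stronglyConnected u (hG.vertices ▸ mem_univ u) m (hG.vertices ▸ mem_univ m) hum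
    induction hpath using Relation.TransGen.head_induction_on with
    | single hpm => exact hback hpm.2.2 rfl
    | @head p q hpq _ ih =>
      rcases eq_or_ne q m with rfl | hqm
      · exact hback hpq.2.2 rfl
      · exact hback hpq.2.2 (ih hqm)
  exact (hall i).trans (hall k).symm

end Graph

namespace SwitchingTopologies

variable {N M : ℕ} {G : Fin M → WeightedDigraph N} {t : ℕ → ℝ} {n : ℕ → Fin M}
  {Gt : ℝ → WeightedDigraph N}

theorem isSwitchingSignal (hG : SwitchingTopologies G t n Gt) : IsSwitchingSignal t Gt := by
  have ht : IsSwitchingTimes t := ⟨hG.start, hG.dwell⟩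
  refine ⟨ht, fun j s hs => ?_, (finite_range G).subset ?_⟩
  · rw [hG.active j s hs, hG.active j (t j) (left_mem_Ico.2 (ht.strictMono j.lt_succ_self))]
  · rintro _ ⟨s, hs, rfl⟩
    obtain ⟨j, hj⟩ := ht.exists_mem_Ico hs
    exact ⟨n j, (hG.active j s hj).symm⟩

theorem exists_window (hG : SwitchingTopologies G t n Gt) :
    ∃ W, ∀ ℓ, ∀ᶠ s in atTop, ∃ r ∈ Icc s (s + W), (Gt r).laplacian = (G ℓ).laplacian := by
  obtain ⟨W, hW, hreact⟩ := hG.reactivation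
  refine ⟨W, fun ℓ => ?_⟩
  obtain ⟨Ta, Td, hTa, -, hlt, hle, hact, hgap⟩ := hreact ℓ
  have hTa_mono : StrictMono Ta := strictMono_nat_of_lt_succ fun ν => (hlt ν).trans_le (hle ν)
  have hTa_unbdd : ¬ BddAbove (range Ta) := by
    choose k hk using hTa
    obtain rfl : t ∘ k = Ta := funext hk
    have hk_mono : StrictMono k := fun μ ν hμν =>
      hG.isSwitchingSignal.strictMono.lt_iff_lt.1 (hTa_mono hμν)
    exact not_bddAbove_of_tendsto_atTop
      (hG.isSwitchingSignal.tendsto_atTop.comp hk_mono.tendsto_atTop)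
  filter_upwards [eventually_ge_atTop (Ta 0)] with s hs
  obtain ⟨ν, hν⟩ := mem_iUnion.1 ((iUnion_Ico_map_succ_eq_Ici (fun ν => hTa_mono.monotone ν.zero_le)
    hTa_unbdd).ge hs)
  by_cases hd : s < Td ν
  · exact ⟨s, ⟨le_rfl, by linarith⟩, hact ν s ⟨hν.1, hd⟩⟩
  · exact ⟨Ta (ν + 1), ⟨hν.2.le, by linarith [hgap ν]⟩, hact (ν + 1) _ ⟨le_rfl, hlt _⟩⟩

theorem tendsto_sub_of_tendsto_mul_laplacian_mulVec (hG : SwitchingTopologies G t n Gt)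
    {x : ℝ → Fin N → ℝ} {K : Set (Fin N → ℝ)} (hK : IsCompact K) (hxK : MapsTo x (Ici 0) K)
    (hslow : ∀ (W : ℝ) (ρ : ℝ → ℝ), (∀ᶠ s in atTop, s ≤ ρ s ∧ ρ s ≤ s + W) →
      Tendsto (fun s => x (ρ s) - x s) atTop (𝓝 0))
    (herr : ∀ i, Tendsto (fun s => x s i * ((Gt s).laplacian *ᵥ x s) i) atTop (𝓝 0))
    (i k : Fin N) : Tendsto (fun s => x s i - x s k) atTop (𝓝 0) := by
  obtain ⟨W, hW⟩ := hG.exists_window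
  rw [tendsto_iff_ultrafilter]
  intro U hU
  obtain ⟨c, -, hc : Tendsto x U (𝓝 c)⟩ := hK.ultrafilter_le_nhds (U.map x)
    (tendsto_principal.2 (hU ((eventually_ge_atTop 0).mono hxK)))
  have hlimit (ℓ : Fin M) (j : Fin N) : c j * ((G ℓ).laplacian *ᵥ c) j = 0 := by
    obtain ⟨ρ, hρ⟩ := (hW ℓ).choice
    have hρ_top : Tendsto ρ atTop atTop :=
      tendsto_atTop_mono' _ (hρ.mono fun s hs => hs.1.1) tendsto_id
    have hρc : Tendsto (fun s => x (ρ s)) U (𝓝 c) := by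
      simpa using ((hslow W ρ (hρ.mono fun s hs => hs.1)).mono_left hU).add hc
    have hcont : Continuous fun v => v j * ((G ℓ).laplacian *ᵥ v) j := by fun_prop
    refine tendsto_nhds_unique ((hcont.tendsto c).comp hρc) ?_
    refine (((herr j).comp hρ_top).mono_left hU).congr' ?_
    filter_upwards [hU hρ] with s hs
    simp only [Function.comp_apply, hs.2]
  simpa [hG.basis.eq_of_mul_laplacian_mulVec_eq_zero hlimit i k] using
    (tendsto_pi_nhds.1 hc i).sub (tendsto_pi_nhds.1 hc k)

end SwitchingTopologies

/-- The state `(x, η, ζ)` of the closed loop augmented by the two integrals of every agent,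
`η i = ∫ x_i² e_i²` and `ζ i = ∫ x_i e_i`. This turns the closed loop, which has memory, into a
switched differential equation. -/
abbrev LoopState (N : ℕ) := (Fin N → ℝ) × (Fin N → ℝ) × (Fin N → ℝ)

section LoopField

variable {N : ℕ} (b : Fin N → ℝ) (lam1 lam2 : ℝ) (g : WeightedDigraph N) (v : LoopState N)
  (i : Fin N)

/-- The nonlinear PI term `S_i` at an augmented state. -/
noncomputable def loopPI : ℝ := v.1 i ^ 2 / 2 + lam1 * v.2.1 i + lam2 / 2 * v.2.2 i ^ 2

/-- The factor `λ₁ x_i e_i + λ₂ ∫ x_i e_i` of the control input at an augmented state. -/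
noncomputable def loopFactor : ℝ := lam1 * (v.1 i * (g.laplacian *ᵥ v.1) i) + lam2 * v.2.2 i

/-- The control input `u_i` at an augmented state. -/
noncomputable def loopInput : ℝ :=
  loopPI lam1 lam2 v i * Real.cos (loopPI lam1 lam2 v i) * (g.laplacian *ᵥ v.1) i *
    loopFactor lam1 lam2 g v i

/-- The vector field of the augmented closed loop while the graph `g` is active. -/
noncomputable def loopField : LoopState N :=
  (fun i => b i * loopInput lam1 lam2 g v i,
    fun i => v.1 i ^ 2 * (g.laplacian *ᵥ v.1) i ^ 2,
    fun i => v.1 i * (g.laplacian *ᵥ v.1) i)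

@[fun_prop]
theorem contDiff_loopPI : ContDiff ℝ 1 fun v : LoopState N => loopPI lam1 lam2 v i := by
  unfold loopPI
  fun_prop

@[fun_prop]
theorem contDiff_loopFactor : ContDiff ℝ 1 fun v => loopFactor lam1 lam2 g v i := by
  unfold loopFactor
  fun_prop

@[fun_prop]
theorem contDiff_loopInput : ContDiff ℝ 1 fun v => loopInput lam1 lam2 g v i := by
  unfold loopInput
  fun_prop

theorem contDiff_loopField : ContDiff ℝ 1 (loopField b lam1 lam2 g) := by
  unfold loopField
  fun_prop

theorem contDiff_mul_laplacian_mulVec :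
    ContDiff ℝ 1 fun v : LoopState N => v.1 i * (g.laplacian *ᵥ v.1) i := by
  fun_prop

variable {b lam1 lam2 g}

theorem hasDerivWithinAt_loopPI {z : ℝ → LoopState N} {χ s : ℝ} {I : Set ℝ}
    (hz : HasDerivWithinAt z (χ • loopField b lam1 lam2 g (z s)) I s) :
    HasDerivWithinAt (fun r => loopPI lam1 lam2 (z r) i)
      ((b i * (loopPI lam1 lam2 (z s) i * Real.cos (loopPI lam1 lam2 (z s) i)) + 1) *
        (χ * ((z s).1 i * (g.laplacian *ᵥ (z s).1) i * loopFactor lam1 lam2 g (z s) i))) I s := by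
  have hx := hasDerivWithinAt_pi.1 (hasFDerivAt_fst.comp_hasDerivWithinAt s hz) i
  have hint := hasFDerivAt_snd.comp_hasDerivWithinAt s hz
  have hη := hasDerivWithinAt_pi.1 (hasFDerivAt_fst.comp_hasDerivWithinAt s hint) i
  have hζ := hasDerivWithinAt_pi.1 (hasFDerivAt_snd.comp_hasDerivWithinAt s hint) i
  refine ((((hx.fun_pow 2).div_const 2).fun_add (hη.const_mul lam1)).fun_add
    ((hζ.fun_pow 2).const_mul (lam2 / 2))).congr_deriv ?_
  simp [loopField, loopInput, loopFactor]
  ring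

theorem exists_forall_norm_le_of_loopPI_le (hlam1 : 0 < lam1) (hlam2 : 0 < lam2) (c : Fin N → ℝ) :
    ∃ R, ∀ v : LoopState N, (∀ i, 0 ≤ v.2.1 i) → (∀ i, loopPI lam1 lam2 v i ≤ c i) → ‖v‖ ≤ R := by
  refine ⟨max √(2 * ‖c‖) (max (‖c‖ / lam1) √(2 * ‖c‖ / lam2)), fun v hη hS => ?_⟩
  have hbounds (i : Fin N) : v.1 i ^ 2 ≤ 2 * ‖c‖ ∧ lam1 * v.2.1 i ≤ ‖c‖ ∧
      lam2 * v.2.2 i ^ 2 ≤ 2 * ‖c‖ := by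
    have hci : loopPI lam1 lam2 v i ≤ ‖c‖ :=
      (hS i).trans ((le_abs_self _).trans (norm_le_pi_norm c i))
    have hη_term : 0 ≤ lam1 * v.2.1 i := mul_nonneg hlam1.le (hη i)
    have hζ_term : 0 ≤ lam2 * v.2.2 i ^ 2 := by positivity
    have hx_term := sq_nonneg (v.1 i)
    unfold loopPI at hci
    exact ⟨by linarith, by linarith, by linarith⟩
  refine max_le_max ?_ (max_le_max ?_ ?_)
  · exact (pi_norm_le_iff_of_nonneg (by positivity)).2 fun i =>
      Real.abs_le_sqrt (hbounds i).1
  · refine (pi_norm_le_iff_of_nonneg (by positivity)).2 fun i => ?_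
    rw [Real.norm_of_nonneg (hη i), le_div_iff₀' hlam1]
    exact (hbounds i).2.1
  · refine (pi_norm_le_iff_of_nonneg (by positivity)).2 fun i => Real.abs_le_sqrt ?_
    rw [le_div_iff₀' hlam2]
    exact (hbounds i).2.2

end LoopField

section Bounds

variable {N : ℕ} {t : ℕ → ℝ} {σ : ℝ → WeightedDigraph N} {b : Fin N → ℝ} {lam1 lam2 : ℝ}
  {β : LoopState N → ℝ} {T : ℝ} {z : ℝ → LoopState N}

-- `S_i' = (b_i S_i cos S_i + 1) w` for a bounded `w`, so `S_i` cannot cross a zero `c` of the gain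
-- `b_i c cos c + 1`, whatever the sign of `b_i`.
theorem IsSwitchedSolution.loopPI_lt (hσ : IsSwitchingSignal t σ) (hβ : Continuous β) (hT : 0 ≤ T)
    (hz : IsSwitchedSolution (fun g v => β v • loopField b lam1 lam2 g v) t σ (Icc 0 T) z)
    {i : Fin N} {c : ℝ} (hc : b i * (c * Real.cos c) + 1 = 0)
    (h₀ : loopPI lam1 lam2 (z 0) i < c) : loopPI lam1 lam2 (z T) i < c := by
  have hgain : ContDiff ℝ 1 fun y => b i * (y * Real.cos y) + 1 := by fun_prop
  have hrate (g : WeightedDigraph N) : Continuous fun v : LoopState N =>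
      β v * (v.1 i * (g.laplacian *ᵥ v.1) i * loopFactor lam1 lam2 g v i) :=
    hβ.mul ((contDiff_mul_laplacian_mulVec g i).mul (contDiff_loopFactor lam1 lam2 g i)).continuous
  obtain ⟨C, hC⟩ := hσ.exists_forall_norm_le hrate
    (isCompact_Icc.image_of_continuousOn hz.continuousOn)
  exact lt_of_deriv_right_eq_mul (f := fun s => loopPI lam1 lam2 (z s) i) hT
    hgain.locallyLipschitz hc
    ((contDiff_loopPI lam1 lam2 i).continuous.comp_continuousOn hz.continuousOn)
    (fun s hs => hasDerivWithinAt_loopPI i (hz.hasDerivWithinAt_Ici hσ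
      (fun g => hβ.smul (contDiff_loopField b lam1 lam2 g).continuous) hs.1
      (Icc_mem_nhdsGE_of_mem hs)))
    (fun s hs => hC s hs.1 _ (mem_image_of_mem z (Ico_subset_Icc_self hs))) h₀

theorem IsSwitchedSolution.le_snd_fst (hσ : IsSwitchingSignal t σ) (hβ : Continuous β)
    (hβ₀ : ∀ v, 0 ≤ β v) (hT : 0 ≤ T)
    (hz : IsSwitchedSolution (fun g v => β v • loopField b lam1 lam2 g v) t σ (Icc 0 T) z)
    (i : Fin N) : (z 0).2.1 i ≤ (z T).2.1 i := by
  have hη : ContinuousOn (fun s => (z s).2.1 i) (Icc 0 T) :=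
    (by fun_prop : Continuous fun v : LoopState N => v.2.1 i).comp_continuousOn hz.continuousOn
  refine image_le_image_of_deriv_right_nonneg
    (f' := fun s => β (z s) * ((z s).1 i ^ 2 * ((σ s).laplacian *ᵥ (z s).1) i ^ 2)) hT hη
    (fun s hs => ?_) (fun s _ => mul_nonneg (hβ₀ (z s)) (by positivity))
  exact hasDerivWithinAt_pi.1 (hasFDerivAt_fst.comp_hasDerivWithinAt s
    (hasFDerivAt_snd.comp_hasDerivWithinAt s (hz.hasDerivWithinAt_Ici hσ
      (fun g => hβ.smul (contDiff_loopField b lam1 lam2 g).continuous) hs.1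
      (Icc_mem_nhdsGE_of_mem hs)))) i

theorem exists_forall_norm_le_of_isSwitchedSolution_loopField (hσ : IsSwitchingSignal t σ)
    (hb : ∀ i, b i ≠ 0) (hlam1 : 0 < lam1) (hlam2 : 0 < lam2) (x₀ : Fin N → ℝ) :
    ∃ R, ∀ β : LoopState N → ℝ, Continuous β → (∀ v, β v ∈ Icc 0 1) → ∀ T ≥ 0, ∀ z,
      IsSwitchedSolution (fun g v => β v • loopField b lam1 lam2 g v) t σ (Icc 0 T) z →
      z 0 = (x₀, 0, 0) → ‖z T‖ ≤ R := by
  choose c hc_gt hc using fun i => exists_gt_mul_cos_eq (x₀ i ^ 2 / 2) (-(b i)⁻¹)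
  obtain ⟨R, hR⟩ := exists_forall_norm_le_of_loopPI_le hlam1 hlam2 c
  refine ⟨R, fun β hβ hβ_mem T hT z hz hz₀ => hR _ (fun i => ?_) (fun i => ?_)⟩
  · simpa [hz₀] using hz.le_snd_fst hσ hβ (fun v => (hβ_mem v).1) hT i
  · refine (hz.loopPI_lt hσ hβ hT ?_ ?_).le
    · rw [hc i, mul_neg, mul_inv_cancel₀ (hb i), neg_add_cancel]
    · simpa [hz₀, loopPI] using hc_gt i

end Bounds

section Augment

variable {N : ℕ} {t : ℕ → ℝ} {σ : ℝ → WeightedDigraph N} {b : Fin N → ℝ} {lam1 lam2 : ℝ}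
  {x : ℝ → Fin N → ℝ}

/-- The trajectory `x` of the agents together with the two integrals along it. -/
noncomputable def augment (σ : ℝ → WeightedDigraph N) (x : ℝ → Fin N → ℝ) (s : ℝ) : LoopState N :=
  (x s, fun i => ∫ r in (0 : ℝ)..s, x r i ^ 2 * ((σ r).laplacian *ᵥ x r) i ^ 2,
    fun i => ∫ r in (0 : ℝ)..s, x r i * ((σ r).laplacian *ᵥ x r) i)

theorem augment_zero : augment σ x 0 = (x 0, 0, 0) := by
  simp only [augment, intervalIntegral.integral_same]
  rfl

theorem controlInput_eq_loopInput (i : Fin N) (s : ℝ) :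
    controlInput σ lam1 lam2 x i s = loopInput lam1 lam2 (σ s) (augment σ x s) i := by
  simp only [controlInput, piTerm, relErr_eq_laplacian_mulVec]
  rfl

theorem IsClosedLoopSolution.isSwitchedSolution_augment (hσ : IsSwitchingSignal t σ) {I : Set ℝ}
    (hx : IsClosedLoopSolution σ t b lam1 lam2 I x) {T : ℝ} (hT : 0 ≤ T) (hI : Icc 0 T ⊆ I) :
    IsSwitchedSolution (loopField b lam1 lam2) t σ (Icc 0 T) (augment σ x) := by
  have hxT := hx.continuousOn.mono hI
  have hsq (i : Fin N) (g : WeightedDigraph N) :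
      Continuous fun v : Fin N → ℝ => v i ^ 2 * (g.laplacian *ᵥ v) i ^ 2 := by fun_prop
  have hmul (i : Fin N) (g : WeightedDigraph N) :
      Continuous fun v : Fin N → ℝ => v i * (g.laplacian *ᵥ v) i := by fun_prop
  constructor
  · exact hxT.prodMk ((continuousOn_pi.2 fun i => hσ.continuousOn_integral (hsq i) hT hxT).prodMk
      (continuousOn_pi.2 fun i => hσ.continuousOn_integral (hmul i) hT hxT))
  · intro s hs hst
    have hsT : s ∈ Ioo 0 T := interior_Icc.le hs
    refine HasDerivAt.prodMk (hasDerivAt_pi.2 fun i => ?_) ((hasDerivAt_pi.2 fun i =>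
      hσ.hasDerivAt_integral (hsq i) hxT hsT hst).prodMk (hasDerivAt_pi.2 fun i =>
      hσ.hasDerivAt_integral (hmul i) hxT hsT hst))
    simpa only [controlInput_eq_loopInput] using hx.hasDerivAt s (interior_mono hI hs) hst i

theorem IsSwitchedSolution.augment_fst (hσ : IsSwitchingSignal t σ) {z : ℝ → LoopState N} {T : ℝ}
    (hT : 0 ≤ T) (hz : IsSwitchedSolution (loopField b lam1 lam2) t σ (Icc 0 T) z)
    (hz₀ : (z 0).2 = 0) : augment σ (fun s => (z s).1) T = z T := by
  have hint (φ : LoopState N →L[ℝ] ℝ) := hz.integral_clm_comp hσ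
    (fun g => (contDiff_loopField b lam1 lam2 g).continuous) hT φ
  refine Prod.ext rfl (Prod.ext (funext fun i => ?_) (funext fun i => ?_))
  · exact (hint (.proj i ∘L .fst ℝ _ _ ∘L .snd ℝ _ _)).trans (sub_eq_self.2 (by simp [hz₀]))
  · exact (hint (.proj i ∘L .snd ℝ _ _ ∘L .snd ℝ _ _)).trans (sub_eq_self.2 (by simp [hz₀]))

theorem exists_isClosedLoopSolution (hσ : IsSwitchingSignal t σ) (hb : ∀ i, b i ≠ 0)
    (hlam1 : 0 < lam1) (hlam2 : 0 < lam2) (x₀ : Fin N → ℝ) :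
    ∃ x, IsClosedLoopSolution σ t b lam1 lam2 (Ici 0) x ∧ x 0 = x₀ := by
  obtain ⟨R, hR⟩ := exists_forall_norm_le_of_isSwitchedSolution_loopField hσ hb hlam1 hlam2 x₀
  obtain ⟨z, hz, hz₀⟩ := exists_isSwitchedSolution_Ici_of_norm_le hσ
    (contDiff_loopField b lam1 lam2) hR
  refine ⟨fun s => (z s).1, ⟨hz.continuousOn.fst, fun s hs hst i => ?_⟩, congrArg Prod.fst hz₀⟩
  rw [controlInput_eq_loopInput, (hz.mono Icc_subset_Ici_self).augment_fst hσ
    (interior_subset hs) (congrArg Prod.snd hz₀)]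
  exact hasDerivAt_pi.1 (hasFDerivAt_fst.comp_hasDerivAt s (hz.hasDerivAt s hs hst)) i

theorem IsClosedLoopSolution.eqOn_Ico (hσ : IsSwitchingSignal t σ) {y : ℝ → Fin N → ℝ} {T : ℝ}
    (hy : IsClosedLoopSolution σ t b lam1 lam2 (Ico 0 T) y)
    (hx : IsClosedLoopSolution σ t b lam1 lam2 (Ici 0) x) (h₀ : y 0 = x 0) :
    EqOn y x (Ico 0 T) := fun s hs => by
  have heq := (hy.isSwitchedSolution_augment hσ hs.1 (Icc_subset_Ico_right hs.2)).eqOn_Icc hσ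
    (fun g => (contDiff_loopField b lam1 lam2 g).locallyLipschitz)
    (hx.isSwitchedSolution_augment hσ hs.1 Icc_subset_Ici_self)
    (by rw [augment_zero, augment_zero, h₀])
  exact congrArg Prod.fst (heq (right_mem_Icc.2 hs.1))

theorem IsClosedLoopSolution.exists_isSwitchedSolution_augment (hσ : IsSwitchingSignal t σ)
    (hb : ∀ i, b i ≠ 0) (hlam1 : 0 < lam1) (hlam2 : 0 < lam2)
    (hx : IsClosedLoopSolution σ t b lam1 lam2 (Ici 0) x) :
    IsSwitchedSolution (loopField b lam1 lam2) t σ (Ici 0) (augment σ x) ∧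
      ∃ K, IsCompact K ∧ MapsTo (augment σ x) (Ici 0) K := by
  have hz (T : ℝ) (hT : 0 ≤ T) := hx.isSwitchedSolution_augment hσ hT Icc_subset_Ici_self
  obtain ⟨R, hR⟩ := exists_forall_norm_le_of_isSwitchedSolution_loopField hσ hb hlam1 hlam2 (x 0)
  refine ⟨.Ici_of_forall_Icc hz, _, isCompact_closedBall 0 R, fun s hs => ?_⟩
  exact mem_closedBall_zero_iff.2 (hR (fun _ => 1) continuous_const
    (fun _ => right_mem_Icc.2 zero_le_one) s hs _ (by simpa only [one_smul] using hz s hs)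
    augment_zero)

end Augment

namespace IsSwitchedSolution

variable {N : ℕ} {t : ℕ → ℝ} {σ : ℝ → WeightedDigraph N} {b : Fin N → ℝ} {lam1 lam2 : ℝ}
  {z : ℝ → LoopState N} {K : Set (LoopState N)}

theorem tendsto_mul_laplacian_mulVec (hσ : IsSwitchingSignal t σ)
    (hz : IsSwitchedSolution (loopField b lam1 lam2) t σ (Ici 0) z) (hK : IsCompact K)
    (hzK : MapsTo z (Ici 0) K) (i : Fin N) :
    Tendsto (fun s => (z s).1 i * ((σ s).laplacian *ᵥ (z s).1) i) atTop (𝓝 0) := by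
  have hF (g : WeightedDigraph N) := (contDiff_loopField b lam1 lam2 g).continuous
  have hη : Continuous fun v : LoopState N => v.2.1 i := by fun_prop
  obtain ⟨C, hC⟩ := hz.exists_lipschitzOnWith_comp hσ hF hK hzK
    fun g => (contDiff_mul_laplacian_mulVec g i).locallyLipschitz
  refine hσ.tendsto_zero_of_lipschitzOnWith hC (hη.comp_continuousOn hz.continuousOn)
    (fun s hs => ?_) ?_
  · have hint := hasFDerivAt_snd.comp_hasDerivWithinAt s (hz.hasDerivWithinAt_Ici hσ hF hs
      (mem_of_superset self_mem_nhdsWithin (Ici_subset_Ici.2 hs)))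
    refine (hasDerivWithinAt_pi.1 (hasFDerivAt_fst.comp_hasDerivWithinAt s hint) i).congr_deriv ?_
    rw [Real.norm_eq_abs, sq_abs, mul_pow]
    rfl
  · refine (hK.bddAbove_image hη.continuousOn).mono ?_
    rintro _ ⟨s, hs, rfl⟩
    exact mem_image_of_mem _ (hzK hs)

theorem tendsto_mul_loopInput (hσ : IsSwitchingSignal t σ)
    (hz : IsSwitchedSolution (loopField b lam1 lam2) t σ (Ici 0) z) (hK : IsCompact K)
    (hzK : MapsTo z (Ici 0) K) (i : Fin N) :
    Tendsto (fun s => (z s).1 i * loopInput lam1 lam2 (σ s) (z s) i) atTop (𝓝 0) := by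
  have hgain (g : WeightedDigraph N) : ContDiff ℝ 1 fun v =>
      loopPI lam1 lam2 v i * Real.cos (loopPI lam1 lam2 v i) * loopFactor lam1 lam2 g v i := by
    fun_prop
  obtain ⟨C, hC⟩ := hσ.exists_forall_norm_le (fun g => (hgain g).continuous) hK
  have hbdd := isBoundedUnder_of_eventually_le
    ((eventually_ge_atTop 0).mono fun s hs => hC s hs (z s) (hzK hs))
  refine ((hz.tendsto_mul_laplacian_mulVec hσ hK hzK i).zero_mul_isBoundedUnder_le hbdd).congr
    fun s => ?_
  unfold loopInput
  ring

theorem tendsto_fst_sub (hσ : IsSwitchingSignal t σ)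
    (hz : IsSwitchedSolution (loopField b lam1 lam2) t σ (Ici 0) z) (hK : IsCompact K)
    (hzK : MapsTo z (Ici 0) K) {W : ℝ} {ρ : ℝ → ℝ}
    (hρ : ∀ᶠ s in atTop, s ≤ ρ s ∧ ρ s ≤ s + W) :
    Tendsto (fun s => (z (ρ s)).1 - (z s).1) atTop (𝓝 0) := by
  refine tendsto_pi_nhds.2 fun i => ?_
  have hxi : Continuous fun v : LoopState N => v.1 i := by fun_prop
  refine tendsto_image_sub_of_tendsto_mul_deriv_right (hxi.comp_continuousOn hz.continuousOn)
    (fun s hs => hasDerivWithinAt_pi.1 (hasFDerivAt_fst.comp_hasDerivWithinAt s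
      (hz.hasDerivWithinAt_Ici hσ (fun g => (contDiff_loopField b lam1 lam2 g).continuous) hs
        (mem_of_superset self_mem_nhdsWithin (Ici_subset_Ici.2 hs)))) i) ?_ hρ
  have hlim := (hz.tendsto_mul_loopInput hσ hK hzK i).const_mul (b i)
  rw [mul_zero] at hlim
  exact hlim.congr fun s => mul_left_comm _ _ _

end IsSwitchedSolution

theorem theorem1 {N M : ℕ} (G : Fin M → WeightedDigraph N) (t : ℕ → ℝ) (n : ℕ → Fin M)
    (Gt : ℝ → WeightedDigraph N) (hG : SwitchingTopologies G t n Gt)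
    (b : Fin N → ℝ) (hb : ∀ i, b i ≠ 0)
    (lam1 lam2 : ℝ) (hlam1 : 0 < lam1) (hlam2 : 0 < lam2) (x0 : Fin N → ℝ) :
    (∃ x : ℝ → Fin N → ℝ, IsClosedLoopSolution Gt t b lam1 lam2 (Ici 0) x ∧ x 0 = x0 ∧
      ∀ (T : ℝ) (y : ℝ → Fin N → ℝ),
        IsClosedLoopSolution Gt t b lam1 lam2 (Ico 0 T) y → y 0 = x0 → EqOn y x (Ico 0 T)) ∧
    (∀ x : ℝ → Fin N → ℝ, IsClosedLoopSolution Gt t b lam1 lam2 (Ici 0) x → x 0 = x0 →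
      (∀ i, ∃ C : ℝ, ∀ s, 0 ≤ s → |x s i| ≤ C) ∧
      (∀ i, ∃ C : ℝ, ∀ s, 0 ≤ s → |controlInput Gt lam1 lam2 x i s| ≤ C) ∧
      (∀ i k, Tendsto (fun s => x s i - x s k) atTop (𝓝 0))) := by
  have hσ := hG.isSwitchingSignal
  refine ⟨?_, fun x hx _ => ?_⟩
  · obtain ⟨x, hx, hx₀⟩ := exists_isClosedLoopSolution hσ hb hlam1 hlam2 x0
    exact ⟨x, hx, hx₀, fun T y hy hy₀ => hy.eqOn_Ico hσ hx (hy₀.trans hx₀.symm)⟩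
  obtain ⟨hz, K, hK, hzK⟩ := hx.exists_isSwitchedSolution_augment hσ hb hlam1 hlam2
  refine ⟨fun i => ?_, fun i => ?_, ?_⟩
  · obtain ⟨C, hC⟩ := hσ.exists_forall_norm_le (Φ := fun _ (v : LoopState N) => v.1 i)
      (fun _ => by fun_prop) hK
    exact ⟨C, fun s hs => hC s hs _ (hzK hs)⟩
  · obtain ⟨C, hC⟩ := hσ.exists_forall_norm_le
      (fun g => (contDiff_loopInput lam1 lam2 g i).continuous) hK
    exact ⟨C, fun s hs => by
      rw [controlInput_eq_loopInput]
      exact hC s hs _ (hzK hs)⟩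
  · exact hG.tendsto_sub_of_tendsto_mul_laplacian_mulVec (hK.image continuous_fst)
      (fun s hs => mem_image_of_mem _ (hzK hs)) (fun W ρ hρ => hz.tendsto_fst_sub hσ hK hzK hρ)
      (hz.tendsto_mul_laplacian_mulVec hσ hK hzK)
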